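/- For every $d\ge 1$ there is a constant $C_d>0$, depending only on $d$, such that the following holds. Let $c_1>0$, let $N\ge 1$, and let $\Lambda_1,\dots,\Lambda_N$ be (full rank) lattices in $\mathbb{R}^d$ with $\mathrm{vol}\,\Lambda_i\ge c_1$ for all $i$. For each $i$ let $f_i\in L^1(\mathbb{R}^d)$ be a complex-valued function that tiles with $\Lambda_i$ at a non-zero level, that is, there is a constant $w_i\neq 0$ with $$\sum_{\lambda\in\Lambda_i} f_i(x-\lambda)=w_i\quad\text{for almost every }x\in\mathbb{R}^d .$$ Suppose that either all the $f_i$ have bounded support, or all the $f_i$ are (almost everywhere) real and nonnegative. Let $f=f_1*f_2*\cdots*f_N$. Then $$\mathrm{diam}\,\mathrm{supp}\, f\ \ge\ C_d\,c_1^{1/d}\,N .$$ Here the support of a function is the complement of the largest open set on which it vanishes almost everywhere, and the diameter is Euclidean, with value $+\infty$ for unbounded sets. -/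

import Mathlib

open MeasureTheory Topology
open scoped ENNReal

/-- The function `f` tiles with the translation set `Λ` at level `c`:
`∑_{λ ∈ Λ} f (x - λ) = c` for almost every `x`, with unconditional (for complex series:
absolute) convergence. -/
def TilesAtLevel {d : ℕ} (f : EuclideanSpace ℝ (Fin d) → ℂ)
    (Λ : Set (EuclideanSpace ℝ (Fin d))) (c : ℂ) : Prop :=
  ∀ᵐ x ∂(volume : Measure (EuclideanSpace ℝ (Fin d))),
    HasSum (fun l : Λ => f (x - (l : EuclideanSpace ℝ (Fin d)))) c

/-- The support of an almost everywhere defined function: the points none of whose neighbourhoods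
`U` satisfies `f = 0` a.e. on `U`, i.e. the complement of the largest open set on which `f`
vanishes almost everywhere. It only depends on the a.e. class of `f`. -/
def essSupp {d : ℕ} (f : EuclideanSpace ℝ (Fin d) → ℂ) : Set (EuclideanSpace ℝ (Fin d)) :=
  {x | ∀ U ∈ 𝓝 x, volume (U ∩ Function.support f) ≠ 0}

/-- The convolution `f₁ * f₂ * ⋯ * f_N` (with respect to Lebesgue measure) for `N ≥ 1`,
where `(g * h)(x) = ∫ g(t) h(x - t) dt`. The value at `N = 0` is irrelevant. -/
noncomputable def iterConv {d : ℕ} :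
    (N : ℕ) → (Fin N → EuclideanSpace ℝ (Fin d) → ℂ) → EuclideanSpace ℝ (Fin d) → ℂ
  | 0, _ => 0
  | 1, f => f 0
  | n + 2, f =>
      convolution (iterConv (n + 1) (Fin.init f)) (f (Fin.last (n + 1)))
        (ContinuousLinearMap.mul ℝ ℂ) volume

/-! Tiling at a non-zero level forces the translates of the support to cover almost everything, so
each factor has support of measure at least `c₁`, and hence is wide in some coordinate direction.
Widths add under convolution by Titchmarsh's theorem in half-spaces: the essential infimum of a
linear form over the support is additive. Averaging over the `d` coordinates gives one direction in
which a fixed share of all the widths accumulates.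

For nonnegative functions additivity is Fubini. For bounded supports, vanishing on `{ℓ < T}` is
equivalent to decay `O(e^{-Tx})` of the Fourier-Laplace transform (Phragmén-Lindelöf and Liouville).
Multiplication by a linear form acts as a derivation on convolutions, and with primes denoting it on
transforms `u`, `v`, `(uv')² = (uv)'(uv') - (uv)(u'v')`. This makes the best decay exponents of the
products `u⁽ᵐ⁾v⁽ⁿ⁾`, `m + n ≤ k`, concave in `k`. They are bounded below, so they never drop
(`VanishBelow.conv_iterate_momentMul`). Thus for almost every `x` with `ℓ x < T` all moments of `t ↦
f (x - t) g t` vanish, this product is zero almost everywhere, and Fubini finishes. -/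

open Complex Filter Set
open scoped FourierTransform ContDiff

/-! ### A Phragmén-Lindelöf argument for Laplace transforms -/

/-- If the Laplace transform of `h` along a bounded function `φ` stays bounded on `[0, ∞)`, then
`h` has integral zero over `{φ < 0}`. -/
theorem setIntegral_eq_zero_of_laplace_bounded {α : Type*} [MeasurableSpace α] {μ : Measure α}
    {h : α → ℂ} {φ : α → ℝ} (hh : Integrable h μ) (hφ : Measurable φ) {R : ℝ}
    (hR : ∀ᵐ y ∂μ, h y ≠ 0 → |φ y| ≤ R) {C : ℝ}
    (hC : ∀ x : ℝ, 0 ≤ x → ‖∫ y, cexp (-(x * φ y)) * h y ∂μ‖ ≤ C) :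
    ∫ y in {y | φ y < 0}, h y ∂μ = 0 := by
  have hs : MeasurableSet {y | φ y < 0} := measurableSet_lt hφ measurable_const
  set k : α → ℂ := {y | φ y < 0}.indicator h with hk
  have hki : Integrable k μ := hh.indicator hs
  have hkh : ∀ y, ‖k y‖ ≤ ‖h y‖ := fun y => norm_indicator_le_norm_self _ _
  have hkR : ∀ᵐ y ∂μ, k y ≠ 0 → |φ y| ≤ R := by
    filter_upwards [hR] with y hy h0
    exact hy fun h1 => h0 (by simp [hk, indicator, h1])
  have hkneg : ∀ y, k y ≠ 0 → φ y < 0 := fun y hy => by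
    by_contra h1
    exact hy (indicator_of_notMem (s := {y | φ y < 0}) h1 h)
  have hcm : ∀ z : ℂ, Measurable fun y => cexp (-(z * φ y)) := fun z => by fun_prop
  have hn : ∀ (z : ℂ) (y : α), ‖cexp (-(z * φ y))‖ = Real.exp (-(z.re * φ y)) := fun z y => by
    simp [Complex.norm_exp]
  have hexpR : ∀ (z : ℂ) (y : α), |φ y| ≤ R → ‖cexp (-(z * φ y))‖ ≤ Real.exp (R * ‖z‖) := by
    intro z y hy
    rw [hn]
    apply Real.exp_le_exp.2
    calc -(z.re * φ y) ≤ |z.re * φ y| := neg_le_abs _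
      _ = |z.re| * |φ y| := abs_mul _ _
      _ ≤ ‖z‖ * R := mul_le_mul (abs_re_le_norm z) hy (abs_nonneg _) (norm_nonneg _)
      _ = R * ‖z‖ := mul_comm _ _
  have hbound : ∀ (q : α → ℂ), (∀ᵐ y ∂μ, q y ≠ 0 → |φ y| ≤ R) → ∀ z : ℂ, ∀ᵐ y ∂μ,
      ‖cexp (-(z * φ y)) * q y‖ ≤ Real.exp (R * ‖z‖) * ‖q y‖ := by
    intro q hq z
    filter_upwards [hq] with y hy
    by_cases h0 : q y = 0
    · simp [h0]
    · rw [norm_mul]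
      exact mul_le_mul_of_nonneg_right (hexpR z y (hy h0)) (norm_nonneg _)
  have hint : ∀ (q : α → ℂ), Integrable q μ → (∀ᵐ y ∂μ, q y ≠ 0 → |φ y| ≤ R) → ∀ z : ℂ,
      Integrable (fun y => cexp (-(z * φ y)) * q y) μ := fun q hqi hq z =>
    (hqi.norm.const_mul (Real.exp (R * ‖z‖))).mono'
      ((hcm z).aestronglyMeasurable.mul hqi.1) (hbound q hq z)
  set P : ℂ → ℂ := fun z => ∫ y, cexp (-(z * φ y)) * k y ∂μ with hP
  have hPdiff : Differentiable ℂ P := by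
    intro z
    refine (hasDerivAt_integral_of_dominated_loc_of_deriv_le (Metric.ball_mem_nhds z one_pos)
      (F' := fun w y => cexp (-(w * φ y)) * (-(φ y)) * k y)
      (bound := fun y => Real.exp (R * (‖z‖ + 1)) * R * ‖k y‖)
      (Eventually.of_forall fun w => (hint k hki hkR w).1) (hint k hki hkR z)
      ?_ ?_ ?_ ?_).2.differentiableAt
    · have : Measurable fun y => cexp (-(z * φ y)) * (-(φ y) : ℂ) := by fun_prop
      exact this.aestronglyMeasurable.mul hki.1
    · filter_upwards [hkR] with y hy w hw
      by_cases h0 : k y = 0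
      · simp [h0]
      · have hyR := hy h0
        have hR0 : 0 ≤ R := (abs_nonneg _).trans hyR
        have hw' : ‖w‖ ≤ ‖z‖ + 1 := by
          have := norm_sub_norm_le w z
          rw [Metric.mem_ball, dist_eq_norm] at hw
          linarith
        rw [norm_mul, norm_mul, norm_neg, norm_real, Real.norm_eq_abs]
        gcongr
        exact (hexpR w y hyR).trans (Real.exp_le_exp.2 (by gcongr))
    · exact hki.norm.const_mul _
    · refine Eventually.of_forall fun y w _ => ?_
      have h1 : HasDerivAt (fun w : ℂ => -(w * φ y)) (-(φ y : ℂ)) w := by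
        simpa using ((hasDerivAt_id w).mul_const (φ y : ℂ)).fun_neg
      exact (h1.cexp).mul_const _
  -- On `{φ < 0}` the kernel has modulus at most 1 when `Re z ≤ 0`.
  have hleft : ∀ z : ℂ, z.re ≤ 0 → ‖P z‖ ≤ ∫ y, ‖h y‖ ∂μ := by
    intro z hz
    refine norm_integral_le_of_norm_le hh.norm (Eventually.of_forall fun y => ?_)
    by_cases h0 : k y = 0
    · simp [h0]
    · rw [norm_mul, hn]
      calc _ ≤ 1 * ‖k y‖ := by
            gcongr
            exact Real.exp_le_one_iff.2 (by nlinarith [hkneg y h0])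
        _ ≤ _ := by simpa using hkh y
  have hreal : ∀ x : ℝ, 0 ≤ x → ‖P x‖ ≤ C + ∫ y, ‖h y‖ ∂μ := by
    intro x hx
    -- The subtracted part lives on `{φ ≥ 0}`, where the kernel is at most 1 for `x ≥ 0`.
    have e : P x = (∫ y, cexp (-(x * φ y)) * h y ∂μ)
        - ∫ y, cexp (-(x * φ y)) * (h y - k y) ∂μ := by
      rw [← integral_sub (hint h hh hR x)]
      · simp only [hP]; congr 1; ext y; ring
      · refine hint _ (hh.sub hki) ?_ x
        filter_upwards [hR] with y hy h0
        exact hy fun h1 => h0 (by simp [hk, indicator, h1])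
    rw [e]
    refine (norm_sub_le _ _).trans (add_le_add (hC x hx) ?_)
    refine norm_integral_le_of_norm_le hh.norm (Eventually.of_forall fun y => ?_)
    by_cases h0 : φ y < 0
    · simp [hk, h0]
    · rw [norm_mul, hn]
      have : k y = 0 := indicator_of_notMem (s := {y | φ y < 0}) h0 h
      rw [this, sub_zero]
      refine mul_le_of_le_one_left (norm_nonneg _) (Real.exp_le_one_iff.2 ?_)
      rw [ofReal_re]
      nlinarith [mul_nonneg hx (not_lt.1 h0)]
  have hright : ∀ z : ℂ, 0 ≤ z.re → ‖P z‖ ≤ ∫ y, ‖h y‖ ∂μ := by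
    intro z hz
    -- Bounded support in `φ` gives exponential type, that is order 1, below the critical order 2 of
    -- a half-plane.
    refine PhragmenLindelof.right_half_plane_of_bounded_on_real hPdiff.diffContOnCl
      ⟨1, by norm_num, R, ?_⟩ ?_ ?_ hz
    · refine Asymptotics.IsBigO.of_bound (∫ y, ‖k y‖ ∂μ) (Eventually.of_forall fun w => ?_)
      rw [Real.norm_eq_abs, Real.abs_exp, Real.rpow_one, mul_comm, ← integral_const_mul]
      exact norm_integral_le_of_norm_le (hki.norm.const_mul _) (hbound k hkR w)
    · exact isBoundedUnder_of_eventually_le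
        (a := C + ∫ y, ‖h y‖ ∂μ) ((eventually_ge_atTop 0).mono fun x hx => hreal x hx)
    · exact fun x => hleft _ (by simp)
  have hb : Bornology.IsBounded (range P) := by
    refine isBounded_iff_forall_norm_le.2 ⟨∫ y, ‖h y‖ ∂μ, ?_⟩
    rintro _ ⟨z, rfl⟩
    rcases le_total z.re 0 with hz | hz
    exacts [hleft z hz, hright z hz]
  have hlim : Tendsto (fun n : ℕ => P (-(n : ℂ))) atTop (𝓝 0) := by
    have := tendsto_integral_of_dominated_convergence (μ := μ)
      (F := fun (n : ℕ) y => cexp (-(-(n : ℂ) * φ y)) * k y) (f := fun _ => 0) (fun y => ‖k y‖)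
      (fun n => (hint k hki hkR _).1) hki.norm ?_ ?_
    · simpa [hP] using this
    · refine fun n => Eventually.of_forall fun y => ?_
      by_cases h0 : k y = 0
      · simp [h0]
      · rw [norm_mul, hn]
        refine mul_le_of_le_one_left (norm_nonneg _) (Real.exp_le_one_iff.2 ?_)
        have := hkneg y h0
        have h2 : (0 : ℝ) ≤ n := n.cast_nonneg
        simp only [neg_re, natCast_re]
        nlinarith
    · refine Eventually.of_forall fun y => ?_
      by_cases h0 : k y = 0
      · simp [h0]
      · rw [tendsto_zero_iff_norm_tendsto_zero]
        simp_rw [norm_mul, hn]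
        rw [← zero_mul ‖k y‖]
        refine Tendsto.mul_const _ (Real.tendsto_exp_atBot.comp ?_)
        simp only [neg_re, natCast_re, neg_mul, neg_neg]
        exact tendsto_natCast_atTop_atTop.atTop_mul_const_of_neg (hkneg y h0)
  -- By Liouville `P` is constant, and it tends to 0 along the negative integers.
  have h0 : P 0 = 0 := by
    refine tendsto_nhds_unique ?_ hlim
    simp_rw [fun n : ℕ => hPdiff.apply_eq_apply_of_bounded hb (-(n : ℂ)) 0]
    exact tendsto_const_nhds
  rw [← integral_indicator hs, ← hk]
  simpa [hP] using h0

/-! ### Injectivity of the Fourier transform -/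

section Fourier

variable {V : Type*} [NormedAddCommGroup V] [InnerProductSpace ℝ V] [FiniteDimensional ℝ V]
  [MeasurableSpace V] [BorelSpace V]

/-- An integrable function whose Fourier transform vanishes is zero almost everywhere. -/
theorem ae_eq_zero_of_fourier_eq_zero {f : V → ℂ} (hf : Integrable f volume)
    (h : ∀ ξ, 𝓕 f ξ = 0) : ∀ᵐ x, f x = 0 := by
  refine ae_eq_zero_of_integral_contDiff_smul_eq_zero hf.locallyIntegrable fun g hg hgc => ?_
  have hg₁ : HasCompactSupport (Complex.ofRealCLM ∘ g) := hgc.comp_left rfl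
  have hg₂ : ContDiff ℝ ∞ (Complex.ofRealCLM ∘ g) := by fun_prop
  set G : SchwartzMap V ℂ := hg₁.toSchwartzMap hg₂ with hG
  -- Moving the transform onto `H = 𝓕⁻ G` turns the pairing of `f` with the test function into an
  -- integral of `𝓕 f`.
  have swap : ∀ H : SchwartzMap V ℂ, ∫ ξ, 𝓕 f ξ * H ξ = ∫ x, f x * (𝓕 H) x := fun H => by
    simpa using! VectorFourier.integral_bilin_fourierIntegral_eq_flip (.mul ℂ ℂ) (L := innerₗ V)
      Real.continuous_fourierChar continuous_inner hf (SchwartzMap.integrable (μ := volume) H)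
  have key := swap (𝓕⁻ G)
  rw [FourierTransform.fourier_fourierInv_eq] at key
  simp only [h, zero_mul, integral_zero] at key
  rw [key]
  congr 1
  ext x
  simp [hG, mul_comm]

end Fourier

/-! ### Half-space supports and Fourier-Laplace transforms -/

section HalfSpace


variable {V : Type*}

/-- `F ξ x = O(e^{-Tx})` for `x ≥ 0`, for each `ξ`. -/
def ExpDecay (F : V → ℝ → ℂ) (T : ℝ) : Prop :=
  ∀ ξ, ∃ C : ℝ, ∀ x : ℝ, 0 ≤ x → ‖F ξ x‖ ≤ C * Real.exp (-(T * x))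

variable [NormedAddCommGroup V] [InnerProductSpace ℝ V]

/-- The function `x ↦ ⟪η, x⟫ f x`. -/
noncomputable def momentMul (η : V) (f : V → ℂ) : V → ℂ :=
  fun x => ((inner ℝ η x : ℝ) : ℂ) * f x

theorem iterate_momentMul_apply (η : V) (f : V → ℂ) (n : ℕ) (x : V) :
    (momentMul η)^[n] f x = ((inner ℝ η x : ℝ) : ℂ) ^ n * f x := by
  induction n with
  | zero => simp
  | succ n ih => rw [Function.iterate_succ_apply', momentMul, ih]; ring

/-- The real-linear map `y ↦ -x ℓ(y) - 2πi ⟪y, ξ⟫`. -/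
noncomputable def laplaceExponent (ℓ : V →L[ℝ] ℝ) (ξ : V) (x : ℝ) : V →L[ℝ] ℂ :=
  (-(x : ℂ)) • (ofRealCLM.comp ℓ) - (2 * Real.pi * I) • (ofRealCLM.comp (innerSL ℝ ξ))

theorem laplaceExponent_apply (ℓ : V →L[ℝ] ℝ) (ξ : V) (x : ℝ) (y : V) :
    laplaceExponent ℓ ξ x y = -(x * ℓ y) - 2 * Real.pi * I * (inner ℝ ξ y : ℝ) := by
  simp [laplaceExponent]

theorem norm_cexp_laplaceExponent (ℓ : V →L[ℝ] ℝ) (ξ : V) (x : ℝ) (y : V) :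
    ‖cexp (laplaceExponent ℓ ξ x y)‖ = Real.exp (-(x * ℓ y)) := by
  rw [laplaceExponent_apply, Complex.norm_exp]
  congr 1
  simp

variable [FiniteDimensional ℝ V] [MeasurableSpace V] [BorelSpace V]

/-- Integrable functions vanishing almost everywhere outside some ball. -/
structure IntegrableBdd (f : V → ℂ) : Prop where
  integrable : Integrable f volume
  bdd : ∃ R : ℝ, ∀ᵐ x, f x ≠ 0 → ‖x‖ ≤ R

/-- `f` vanishes almost everywhere on the half-space `{ℓ < T}`. -/
def VanishBelow (ℓ : V →L[ℝ] ℝ) (f : V → ℂ) (T : ℝ) : Prop :=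
  ∀ᵐ x, ℓ x < T → f x = 0

/-- The convolution of complex functions with respect to Lebesgue measure. -/
noncomputable abbrev conv (f g : V → ℂ) : V → ℂ :=
  convolution f g (ContinuousLinearMap.mul ℝ ℂ) volume

/-- The Fourier-Laplace transform of `f`: Laplace along `ℓ`, Fourier in all directions. -/
noncomputable def fourierLaplace (ℓ : V →L[ℝ] ℝ) (f : V → ℂ) (ξ : V) (x : ℝ) : ℂ :=
  ∫ y, cexp (laplaceExponent ℓ ξ x y) * f y

theorem IntegrableBdd.continuous_mul {f : V → ℂ} (hf : IntegrableBdd f) {q : V → ℂ}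
    (hq : Continuous q) : IntegrableBdd fun x => q x * f x := by
  obtain ⟨R, hR⟩ := hf.bdd
  obtain ⟨C, hC⟩ := (isCompact_closedBall (0 : V) R).exists_bound_of_continuousOn hq.continuousOn
  refine ⟨(hf.integrable.norm.const_mul C).mono' (hq.aestronglyMeasurable.mul hf.integrable.1) ?_,
    R, ?_⟩
  · filter_upwards [hR] with x hx
    by_cases h0 : f x = 0
    · simp [h0]
    · rw [norm_mul]
      exact mul_le_mul_of_nonneg_right (hC x (by simpa using hx h0)) (norm_nonneg _)
  · filter_upwards [hR] with x hx h0
    exact hx (right_ne_zero_of_mul h0)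

theorem IntegrableBdd.momentMul {f : V → ℂ} (hf : IntegrableBdd f) (η : V) :
    IntegrableBdd (momentMul η f) :=
  hf.continuous_mul (q := fun x => ((inner ℝ η x : ℝ) : ℂ)) (by fun_prop)

theorem IntegrableBdd.iterate_momentMul {f : V → ℂ} (hf : IntegrableBdd f) (η : V) (n : ℕ) :
    IntegrableBdd ((_root_.momentMul η)^[n] f) := by
  induction n with
  | zero => exact hf
  | succ n ih => rw [Function.iterate_succ_apply']; exact ih.momentMul η

theorem conv_apply (f g : V → ℂ) (x : V) : conv f g x = ∫ t, f t * g (x - t) := rfl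

theorem ae_sub_left {p : V → Prop} (h : ∀ᵐ x, p x) (x : V) : ∀ᵐ t, p (x - t) :=
  (Measure.measurePreserving_sub_left volume x).quasiMeasurePreserving.ae h

theorem integrable_conv {f g : V → ℂ} (hf : Integrable f volume) (hg : Integrable g volume) :
    Integrable (conv f g) volume :=
  hf.integrable_convolution (ContinuousLinearMap.mul ℝ ℂ) hg

theorem ae_integrable_conv_integrand {f g : V → ℂ} (hf : Integrable f volume)
    (hg : Integrable g volume) : ∀ᵐ x : V, Integrable (fun t => f t * g (x - t)) volume :=
  hf.ae_convolution_exists (ContinuousLinearMap.mul ℝ ℂ) hg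

theorem IntegrableBdd.conv {f g : V → ℂ} (hf : IntegrableBdd f) (hg : IntegrableBdd g) :
    IntegrableBdd (conv f g) := by
  refine ⟨integrable_conv hf.integrable hg.integrable, ?_⟩
  obtain ⟨R, hR⟩ := hf.bdd
  obtain ⟨S, hS⟩ := hg.bdd
  refine ⟨R + S, Eventually.of_forall fun x hx => ?_⟩
  by_contra hlt
  refine hx ?_
  rw [conv_apply]
  refine integral_eq_zero_of_ae ?_
  filter_upwards [hR, ae_sub_left hS x] with t h1 h2
  by_contra h0
  have h3 := h1 (left_ne_zero_of_mul h0)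
  have h4 := h2 (right_ne_zero_of_mul h0)
  have h5 : ‖x‖ ≤ ‖t‖ + ‖x - t‖ := by simpa using norm_add_le t (x - t)
  linarith

theorem integral_cexp_mul_conv {f g : V → ℂ} (hf : IntegrableBdd f) (hg : IntegrableBdd g)
    (Φ : V →L[ℝ] ℂ) : ∫ y, cexp (Φ y) * conv f g y
      = (∫ y, cexp (Φ y) * f y) * ∫ y, cexp (Φ y) * g y := by
  have hc : Continuous fun y => cexp (Φ y) := by fun_prop
  have := integral_convolution (ContinuousLinearMap.mul ℝ ℂ) (hf.continuous_mul hc).integrable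
    (hg.continuous_mul hc).integrable
  rw [ContinuousLinearMap.mul_apply'] at this
  rw [← this]
  congr 1
  ext x
  rw [conv_apply, ← integral_const_mul, convolution_def]
  congr 1
  ext t
  have : cexp (Φ x) = cexp (Φ t) * cexp (Φ (x - t)) := by
    rw [← Complex.exp_add, ← map_add, add_sub_cancel]
  rw [ContinuousLinearMap.mul_apply', this]
  ring

theorem fourierLaplace_conv (ℓ : V →L[ℝ] ℝ) {f g : V → ℂ} (hf : IntegrableBdd f)
    (hg : IntegrableBdd g) (ξ : V) (x : ℝ) :
    fourierLaplace ℓ (conv f g) ξ x = fourierLaplace ℓ f ξ x * fourierLaplace ℓ g ξ x :=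
  integral_cexp_mul_conv hf hg _

theorem momentMul_conv {f g : V → ℂ} (hf : IntegrableBdd f) (hg : IntegrableBdd g) (η : V) :
    momentMul η (conv f g) =ᵐ[volume]
      fun x => conv (momentMul η f) g x + conv f (momentMul η g) x := by
  filter_upwards [ae_integrable_conv_integrand (hf.momentMul η).integrable hg.integrable,
    ae_integrable_conv_integrand hf.integrable (hg.momentMul η).integrable] with x h1 h2
  rw [conv_apply, conv_apply, ← integral_add h1 h2, momentMul, conv_apply, ← integral_const_mul]
  congr 1
  ext t
  simp only [momentMul, inner_sub_right, ofReal_sub]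
  ring

theorem fourierLaplace_momentMul_conv (ℓ : V →L[ℝ] ℝ) {f g : V → ℂ} (hf : IntegrableBdd f)
    (hg : IntegrableBdd g) (η ξ : V) (x : ℝ) :
    fourierLaplace ℓ (momentMul η (conv f g)) ξ x
      = fourierLaplace ℓ (momentMul η f) ξ x * fourierLaplace ℓ g ξ x
        + fourierLaplace ℓ f ξ x * fourierLaplace ℓ (momentMul η g) ξ x := by
  rw [← fourierLaplace_conv ℓ (hf.momentMul η) hg, ← fourierLaplace_conv ℓ hf (hg.momentMul η)]
  have hc : Continuous fun y => cexp (laplaceExponent ℓ ξ x y) := by fun_prop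
  simp only [fourierLaplace]
  rw [← integral_add (((hf.momentMul η).conv hg).continuous_mul hc).integrable
    ((hf.conv (hg.momentMul η)).continuous_mul hc).integrable]
  refine integral_congr_ae ?_
  filter_upwards [momentMul_conv hf hg η] with y hy
  rw [hy, mul_add]

theorem VanishBelow.expDecay {ℓ : V →L[ℝ] ℝ} {f : V → ℂ} {T : ℝ} (h : VanishBelow ℓ f T)
    (hf : Integrable f volume) : ExpDecay (fourierLaplace ℓ f) T := by
  refine fun ξ => ⟨∫ y, ‖f y‖, fun x hx => ?_⟩
  rw [fourierLaplace, mul_comm, ← integral_const_mul]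
  refine norm_integral_le_of_norm_le (hf.norm.const_mul _) ?_
  filter_upwards [h] with y hy
  by_cases h0 : f y = 0
  · simp [h0]
  · rw [norm_mul, norm_cexp_laplaceExponent]
    refine mul_le_mul_of_nonneg_right (Real.exp_le_exp.2 ?_) (norm_nonneg _)
    have : T ≤ ℓ y := not_lt.1 fun h1 => h0 (hy h1)
    nlinarith [mul_le_mul_of_nonneg_left this hx]

/-- The Laplace lemma with `φ = ℓ - T`, applied to `f` twisted by the character of `ξ`, shows that
the Fourier transform of `f` cut off to `{ℓ < T}` is zero at `ξ`. Each `ξ` is treated separately, so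
the decay constant may depend on it. -/
theorem ExpDecay.vanishBelow {ℓ : V →L[ℝ] ℝ} {f : V → ℂ} {T : ℝ} (hf : IntegrableBdd f)
    (h : ExpDecay (fourierLaplace ℓ f) T) : VanishBelow ℓ f T := by
  have hm : MeasurableSet {y | ℓ y - T < 0} :=
    measurableSet_lt (by fun_prop) measurable_const
  have key := ae_eq_zero_of_fourier_eq_zero (hf.integrable.indicator hm) fun ξ => ?_
  · filter_upwards [key] with y hy hlt
    rwa [indicator_of_mem (by simpa using hlt)] at hy
  obtain ⟨C, hC⟩ := h ξ
  obtain ⟨R, hR⟩ := hf.bdd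
  have hc : Continuous fun y : V => cexp (-(2 * Real.pi * I * (inner ℝ ξ y : ℝ))) := by fun_prop
  have := setIntegral_eq_zero_of_laplace_bounded (hf.continuous_mul hc).integrable
    (φ := fun y => ℓ y - T) (by fun_prop) (R := ‖ℓ‖ * R + |T|) (C := C) ?_ ?_
  · rw [Real.fourier_eq', ← this, ← integral_indicator hm]
    congr 1
    ext y
    by_cases hy : y ∈ {y | ℓ y - T < 0}
    · rw [indicator_of_mem hy, indicator_of_mem hy, smul_eq_mul, real_inner_comm]
      congr 2
      push_cast
      ring
    · rw [indicator_of_notMem hy, indicator_of_notMem hy, smul_zero]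
  · filter_upwards [hR] with y hy h0
    refine (abs_sub _ _).trans (add_le_add_left ((ℓ.le_opNorm y).trans ?_) _)
    exact mul_le_mul_of_nonneg_left (hy (right_ne_zero_of_mul h0)) (norm_nonneg _)
  · intro x hx
    have e : ∫ y, cexp (-(x * (ℓ y - T : ℝ))) *
        (cexp (-(2 * Real.pi * I * (inner ℝ ξ y : ℝ))) * f y)
          = cexp (x * T) * fourierLaplace ℓ f ξ x := by
      rw [fourierLaplace, ← integral_const_mul]
      congr 1
      ext y
      rw [laplaceExponent_apply, ← mul_assoc, ← mul_assoc, ← Complex.exp_add, ← Complex.exp_add]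
      congr 2
      push_cast
      ring
    rw [e, norm_mul]
    calc _ ≤ Real.exp (x * T) * (C * Real.exp (-(T * x))) := by
          refine mul_le_mul (le_of_eq ?_) (hC x hx) (norm_nonneg _) (Real.exp_pos _).le
          rw [Complex.norm_exp]; simp
      _ = C * (Real.exp (x * T + -(T * x))) := by rw [Real.exp_add]; ring
      _ = C := by rw [mul_comm x T]; simp

end HalfSpace

/-! ### Concavity of decay exponents -/

/-- A concave sequence that is bounded below is nondecreasing. -/
theorem le_of_concave_of_bddBelow {s : ℕ → ℝ} {m : ℝ} (hm : ∀ k, m ≤ s k)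
    (hs : ∀ k, s k + s (k + 2) ≤ 2 * s (k + 1)) (k : ℕ) : s 0 ≤ s k := by
  have hmono : Monotone s := by
    refine monotone_nat_of_le_succ fun k => ?_
    by_contra! hlt
    set δ := s k - s (k + 1) with hδ
    have hδpos : 0 < δ := sub_pos.2 hlt
    have h1 : ∀ n, δ ≤ s (k + n) - s (k + n + 1) := by
      intro n
      induction n with
      | zero => exact le_rfl
      | succ n ih =>
        have := hs (k + n)
        rw [show k + (n + 1) = k + n + 1 by ring]
        linarith
    have h2 : ∀ n : ℕ, s (k + n) ≤ s k - n * δ := by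
      intro n
      induction n with
      | zero => simp
      | succ n ih =>
        have := h1 n
        rw [show k + (n + 1) = k + n + 1 by ring]
        push_cast
        linarith
    obtain ⟨n, hn⟩ := exists_nat_gt ((s k - m) / δ)
    rw [div_lt_iff₀ hδpos] at hn
    linarith [h2 n, hm (k + n)]
  exact hmono k.zero_le

section HalfSpace

variable {V : Type*}

theorem ExpDecay.mono {F : V → ℝ → ℂ} {S T : ℝ} (h : ExpDecay F T) (hST : S ≤ T) :
    ExpDecay F S := by
  intro ξ
  obtain ⟨C, hC⟩ := h ξ
  refine ⟨|C|, fun x hx => (hC x hx).trans ?_⟩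
  exact mul_le_mul (le_abs_self C) (Real.exp_le_exp.2 (by nlinarith)) (Real.exp_pos _).le
    (abs_nonneg _)

theorem ExpDecay.mul {F G : V → ℝ → ℂ} {S T : ℝ} (hF : ExpDecay F S) (hG : ExpDecay G T) :
    ExpDecay (fun ξ x => F ξ x * G ξ x) (S + T) := by
  intro ξ
  obtain ⟨C, hC⟩ := hF ξ
  obtain ⟨C', hC'⟩ := hG ξ
  refine ⟨C * C', fun x hx => ?_⟩
  rw [norm_mul]
  refine (mul_le_mul (hC x hx) (hC' x hx) (norm_nonneg _)
    ((norm_nonneg _).trans (hC x hx))).trans (le_of_eq ?_)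
  rw [add_mul, neg_add, Real.exp_add]
  ring

theorem ExpDecay.sub {F G : V → ℝ → ℂ} {T : ℝ} (hF : ExpDecay F T) (hG : ExpDecay G T) :
    ExpDecay (fun ξ x => F ξ x - G ξ x) T := by
  intro ξ
  obtain ⟨C, hC⟩ := hF ξ
  obtain ⟨C', hC'⟩ := hG ξ
  refine ⟨C + C', fun x hx => (norm_sub_le _ _).trans ?_⟩
  rw [add_mul]
  exact add_le_add (hC x hx) (hC' x hx)

theorem ExpDecay.of_sq {F : V → ℝ → ℂ} {T : ℝ} (hF : ExpDecay (fun ξ x => F ξ x ^ 2) T) :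
    ExpDecay F (T / 2) := by
  intro ξ
  obtain ⟨C, hC⟩ := hF ξ
  refine ⟨√C, fun x hx => ?_⟩
  have h := hC x hx
  rw [norm_pow] at h
  have hC0 : 0 ≤ C := nonneg_of_mul_nonneg_left ((sq_nonneg _).trans h) (Real.exp_pos _)
  refine le_of_sq_le_sq ?_ (by positivity)
  rw [mul_pow, Real.sq_sqrt hC0, ← Real.exp_nat_mul]
  refine h.trans (le_of_eq ?_)
  congr 2
  push_cast
  ring

variable [NormedAddCommGroup V] [InnerProductSpace ℝ V] [FiniteDimensional ℝ V]
  [MeasurableSpace V] [BorelSpace V]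

theorem VanishBelow.momentMul {ℓ : V →L[ℝ] ℝ} {f : V → ℂ} {T : ℝ} (h : VanishBelow ℓ f T)
    (η : V) : VanishBelow ℓ (momentMul η f) T := by
  filter_upwards [h] with x hx hlt
  rw [_root_.momentMul, hx hlt, mul_zero]

/-- The identity `(uv')² = (uv)'(uv') - (uv)(u'v')` bounds the square with exponent `S + T`. The
factor `(uv)'` keeps exponent `S` because a linear weight does not enlarge the support of `conv u
v`. -/
theorem expDecay_mul_momentMul {ℓ : V →L[ℝ] ℝ} {u v : V → ℂ} (hu : IntegrableBdd u)
    (hv : IntegrableBdd v) (η : V) {S T : ℝ}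
    (h₀ : ExpDecay (fun ξ x => fourierLaplace ℓ u ξ x * fourierLaplace ℓ v ξ x) S)
    (h₁ : ExpDecay (fun ξ x => fourierLaplace ℓ u ξ x * fourierLaplace ℓ (momentMul η v) ξ x) T)
    (h₂ : ExpDecay (fun ξ x => fourierLaplace ℓ (momentMul η u) ξ x *
      fourierLaplace ℓ (momentMul η v) ξ x) T) :
    ExpDecay (fun ξ x => fourierLaplace ℓ u ξ x * fourierLaplace ℓ (momentMul η v) ξ x)
      ((S + T) / 2) := by
  have huv := hu.conv hv
  have h₀' : ExpDecay (fourierLaplace ℓ (conv u v)) S := by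
    intro ξ
    simpa only [fourierLaplace_conv ℓ hu hv] using h₀ ξ
  have hD : ExpDecay (fourierLaplace ℓ (momentMul η (conv u v))) S :=
    ((h₀'.vanishBelow huv).momentMul η).expDecay (huv.momentMul η).integrable
  refine ExpDecay.of_sq ?_
  have := (hD.mul h₁).sub (h₀.mul h₂)
  convert this using 3 with ξ x
  rw [fourierLaplace_momentMul_conv ℓ hu hv]
  ring

theorem IntegrableBdd.exists_vanishBelow_iterate {f : V → ℂ} (hf : IntegrableBdd f)
    (ℓ : V →L[ℝ] ℝ) (η : V) : ∃ T, ∀ n, VanishBelow ℓ ((_root_.momentMul η)^[n] f) T := by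
  obtain ⟨R, hR⟩ := hf.bdd
  refine ⟨-(‖ℓ‖ * R), fun n => ?_⟩
  filter_upwards [hR] with x hx hlt
  rw [iterate_momentMul_apply]
  by_contra h0
  have h1 := (ℓ.le_opNorm x).trans
    (mul_le_mul_of_nonneg_left (hx (right_ne_zero_of_mul h0)) (norm_nonneg _))
  have h2 := neg_abs_le (ℓ x)
  rw [Real.norm_eq_abs] at h1
  linarith

/-- Multiplying a factor of a convolution by powers of a linear form preserves the vanishing of the
convolution on a half-space. -/
theorem VanishBelow.conv_iterate_momentMul {ℓ : V →L[ℝ] ℝ} {f g : V → ℂ} {T : ℝ}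
    (hf : IntegrableBdd f) (hg : IntegrableBdd g) (h : VanishBelow ℓ (conv f g) T) (η : V)
    (n : ℕ) : VanishBelow ℓ (conv f ((_root_.momentMul η)^[n] g)) T := by
  set F : ℕ → ℕ → V → ℝ → ℂ := fun m n ξ x =>
    fourierLaplace ℓ ((_root_.momentMul η)^[m] f) ξ x *
      fourierLaplace ℓ ((_root_.momentMul η)^[n] g) ξ x with hF
  have hfi := fun m => hf.iterate_momentMul η m
  have hgi := fun m => hg.iterate_momentMul η m
  have h00 : ExpDecay (F 0 0) T := by
    intro ξ
    have h1 := h.expDecay (hf.conv hg).integrable ξ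
    simp only [fourierLaplace_conv ℓ hf hg] at h1
    exact h1
  -- These bounds do not depend on the number of weights; they supply the lower bound that the
  -- concavity argument needs.
  obtain ⟨A, hA⟩ := hf.exists_vanishBelow_iterate ℓ η
  obtain ⟨B, hB⟩ := hg.exists_vanishBelow_iterate ℓ η
  have hAB : ∀ m n, ExpDecay (F m n) (A + B) := fun m n =>
    ((hA m).expDecay (hfi m).integrable).mul ((hB n).expDecay (hgi n).integrable)
  have stepR : ∀ m n S T', ExpDecay (F m n) S → ExpDecay (F m (n + 1)) T' →
      ExpDecay (F (m + 1) (n + 1)) T' → ExpDecay (F m (n + 1)) ((S + T') / 2) := by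
    intro m n S T' h0 h1 h2
    simp only [hF, Function.iterate_succ_apply'] at h0 h1 h2 ⊢
    exact expDecay_mul_momentMul (hfi m) (hgi n) η h0 h1 h2
  have stepL : ∀ m n S T', ExpDecay (F m n) S → ExpDecay (F (m + 1) n) T' →
      ExpDecay (F (m + 1) (n + 1)) T' → ExpDecay (F (m + 1) n) ((S + T') / 2) := by
    intro m n S T' h0 h1 h2
    simp only [hF, Function.iterate_succ_apply'] at h0 h1 h2 ⊢
    simp only [mul_comm (fourierLaplace ℓ ((_root_.momentMul η)^[m] f) _ _),
      mul_comm (fourierLaplace ℓ (_root_.momentMul η ((_root_.momentMul η)^[m] f)) _ _)]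
      at h0 h1 h2 ⊢
    exact expDecay_mul_momentMul (hgi n) (hfi m) η h0 h1 h2
  -- The cap `S ≤ T` keeps the supremum finite even if some product decays at every rate.
  set G : ℕ → Set ℝ := fun k => {S | S ≤ T ∧ ∀ m n, m + n ≤ k → ExpDecay (F m n) S} with hG
  have hbdd : ∀ k, BddAbove (G k) := fun k => ⟨T, fun S hS => hS.1⟩
  have hmem : ∀ k, min T (A + B) ∈ G k := fun k =>
    ⟨min_le_left _ _, fun m n _ => (hAB m n).mono (min_le_right _ _)⟩
  have hlt : ∀ k S, S < sSup (G k) → S ∈ G k := by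
    intro k S hS
    obtain ⟨S', hS', hlt⟩ := exists_lt_of_lt_csSup ⟨_, hmem k⟩ hS
    exact ⟨hlt.le.trans hS'.1, fun m n hmn => (hS'.2 m n hmn).mono hlt.le⟩
  have hconc : ∀ k, sSup (G k) + sSup (G (k + 2)) ≤ 2 * sSup (G (k + 1)) := by
    intro k
    have hhalf : ∀ S ∈ G k, ∀ S' ∈ G (k + 2), S' ≤ S → (S + S') / 2 ∈ G (k + 1) := by
      intro S hS S' hS' hle
      refine ⟨by linarith [hS.1, hS'.1], fun m n hmn => ?_⟩
      -- A product with `m + n ≤ k + 1` is reached from one of lower order by weighting one factor;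
      -- only `m = n = 0` has no predecessor, and there `S' ≤ S` suffices.
      rcases n with _ | n
      · rcases m with _ | m
        · exact (hS.2 0 0 (by omega)).mono (by linarith)
        · exact stepL m 0 S S' (hS.2 _ _ (by omega)) (hS'.2 _ _ (by omega)) (hS'.2 _ _ (by omega))
      · exact stepR m n S S' (hS.2 _ _ (by omega)) (hS'.2 _ _ (by omega)) (hS'.2 _ _ (by omega))
    have hanti : sSup (G (k + 2)) ≤ sSup (G k) :=
      csSup_le_csSup (hbdd _) ⟨_, hmem _⟩ fun S hS => ⟨hS.1, fun m n _ => hS.2 m n (by omega)⟩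
    -- The suprema need not be attained, hence the margins `ε / 4`.
    refine le_of_forall_pos_lt_add fun ε hε => ?_
    have h1 := hhalf _ (hlt k (sSup (G k) - ε / 4) (by linarith)) _
      (hlt (k + 2) (sSup (G (k + 2)) - ε / 4) (by linarith)) (by linarith)
    have h2 := le_csSup (hbdd _) h1
    linarith
  have hge : T ≤ sSup (G n) := by
    refine le_trans (le_csSup (hbdd 0) ⟨le_rfl, fun m n hmn => ?_⟩)
      (le_of_concave_of_bddBelow (m := min T (A + B)) (fun k => le_csSup (hbdd k) (hmem k)) hconc n)
    obtain ⟨rfl, rfl⟩ : m = 0 ∧ n = 0 := by omega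
    exact h00
  have hS : ∀ S < T, VanishBelow ℓ (conv f ((_root_.momentMul η)^[n] g)) S := by
    intro S hS
    refine ExpDecay.vanishBelow (hf.conv (hgi n)) fun ξ => ?_
    simp only [fourierLaplace_conv ℓ hf (hgi n)]
    exact (hlt n S (hS.trans_le hge)).2 0 n (by omega) ξ
  -- Only exponents `S < T` are available; the open half-space is exhausted by countably many
  -- smaller ones.
  have hseq : ∀ᵐ x, ∀ k : ℕ, ℓ x < T - 1 / (k + 1) →
      conv f ((_root_.momentMul η)^[n] g) x = 0 :=
    ae_all_iff.2 fun k => hS _ (sub_lt_self _ (by positivity))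
  filter_upwards [hseq] with x hx hxT
  obtain ⟨k, hk⟩ := exists_nat_one_div_lt (sub_pos.2 hxT)
  exact hx k (by linarith)

end HalfSpace

/-! ### From vanishing moments to vanishing factors -/

section HalfSpace

variable {V : Type*} [NormedAddCommGroup V] [InnerProductSpace ℝ V] [FiniteDimensional ℝ V]
  [MeasurableSpace V] [BorelSpace V]

/-- Expand the character in its power series; bounded support makes the series of `L¹` norms
converge, so integration is termwise. -/
theorem IntegrableBdd.fourier_eq_zero_of_moments {p : V → ℂ} (hp : IntegrableBdd p) {η : V}
    (h : ∀ n : ℕ, ∫ t, ((inner ℝ η t : ℝ) : ℂ) ^ n * p t = 0) : 𝓕 p η = 0 := by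
  obtain ⟨R, hR⟩ := hp.bdd
  set F : ℕ → V → ℂ := fun n t =>
    (-(2 * Real.pi * I)) ^ n / (n.factorial : ℂ) * (((inner ℝ η t : ℝ) : ℂ) ^ n * p t) with hF
  have hFi : ∀ n, Integrable (F n) volume := fun n =>
    ((hp.continuous_mul (q := fun t => ((inner ℝ η t : ℝ) : ℂ) ^ n) (by fun_prop)).integrable
      ).const_mul _
  have hle : ∀ n, ∫ t, ‖F n t‖ ≤ (2 * Real.pi * (‖η‖ * R)) ^ n / (n.factorial : ℝ)
      * ∫ t, ‖p t‖ := by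
    intro n
    rw [← integral_const_mul]
    refine integral_mono_ae (hFi n).norm (hp.integrable.norm.const_mul _) ?_
    filter_upwards [hR] with t ht
    by_cases h0 : p t = 0
    · simp [hF, h0]
    · have h1 : |inner ℝ η t| ≤ ‖η‖ * R := (abs_real_inner_le_norm η t).trans
        (mul_le_mul_of_nonneg_left (ht h0) (norm_nonneg _))
      have h2 : ‖F n t‖ = (2 * Real.pi * |inner ℝ η t|) ^ n / (n.factorial : ℝ) * ‖p t‖ := by
        rw [mul_pow]
        simp [hF, abs_of_pos Real.pi_pos]
        ring
      rw [h2]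
      gcongr
  have hsum : Summable fun n => ∫ t, ‖F n t‖ :=
    Summable.of_nonneg_of_le (fun n => integral_nonneg fun t => norm_nonneg _) hle
      ((Real.summable_pow_div_factorial _).mul_right _)
  have key := hasSum_integral_of_summable_integral_norm hFi hsum
  have hz : ∀ n, ∫ t, F n t = 0 := fun n => by
    simp only [hF]
    rw [integral_const_mul, h n, mul_zero]
  simp only [hz] at key
  rw [Real.fourier_eq', ← key.unique hasSum_zero]
  congr 1
  ext t
  have := (NormedSpace.expSeries_div_hasSum_exp (-(2 * Real.pi * I) * (inner ℝ η t : ℝ))).mul_right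
    (p t)
  rw [← Complex.exp_eq_exp_ℂ] at this
  have h3 : (fun n => F n t) = fun n =>
      (-(2 * Real.pi * I) * ((inner ℝ η t : ℝ) : ℂ)) ^ n / (n.factorial : ℂ) * p t := by
    ext n
    simp only [hF]
    rw [mul_pow]
    ring
  rw [h3, this.tsum_eq, smul_eq_mul, real_inner_comm]
  congr 2
  push_cast
  ring

theorem continuous_fourier {p : V → ℂ} (hp : Integrable p volume) : Continuous (𝓕 p) :=
  VectorFourier.fourierIntegral_continuous (L := innerₗ V) Real.continuous_fourierChar
    continuous_inner hp

theorem conv_apply_swap (f g : V → ℂ) (x : V) : conv f g x = ∫ t, f (x - t) * g t := by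
  rw [conv_apply, ← integral_sub_left_eq_self _ volume x]
  simp

/-- If the convolution of two functions with bounded support vanishes on a half-space, then so does
almost every integrand. -/
theorem VanishBelow.ae_mul_eq_zero_of_integrableBdd {ℓ : V →L[ℝ] ℝ} {f g : V → ℂ} {T : ℝ}
    (hf : IntegrableBdd f) (hg : IntegrableBdd g) (h : VanishBelow ℓ (conv f g) T) :
    ∀ᵐ x, ℓ x < T → ∀ᵐ t, f (x - t) * g t = 0 := by
  -- Countably many directions give one common null set; continuity of the Fourier transform extends
  -- the vanishing from this dense set to every `ξ`.
  have h1 : ∀ᵐ x, ∀ i n : ℕ, ℓ x < T →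
      conv f ((_root_.momentMul (TopologicalSpace.denseSeq V i))^[n] g) x = 0 :=
    ae_all_iff.2 fun i => ae_all_iff.2 fun n => h.conv_iterate_momentMul hf hg _ n
  filter_upwards [h1, ae_integrable_conv_integrand hf.integrable hg.integrable] with x hx hi hxT
  have hp : IntegrableBdd fun t => f (x - t) * g t := by
    refine ⟨by simpa using hi.comp_sub_left x, ?_⟩
    obtain ⟨R, hR⟩ := hg.bdd
    exact ⟨R, hR.mono fun t ht h0 => ht (right_ne_zero_of_mul h0)⟩
  refine ae_eq_zero_of_fourier_eq_zero hp.integrable fun ξ => ?_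
  refine congrFun ((continuous_fourier hp.integrable).ext_on
    (TopologicalSpace.denseRange_denseSeq V) (continuous_const (y := (0 : ℂ))) ?_) ξ
  rintro _ ⟨i, rfl⟩
  refine hp.fourier_eq_zero_of_moments fun n => ?_
  rw [← hx i n hxT, conv_apply_swap]
  congr 1
  ext t
  rw [iterate_momentMul_apply]
  ring

/-- `f` is almost everywhere real and nonnegative. -/
def AeNonneg (f : V → ℂ) : Prop := ∀ᵐ x, f x = (‖f x‖ : ℂ)

theorem AeNonneg.conv_eq {f g : V → ℂ} (hf : AeNonneg f) (hg : AeNonneg g) (x : V) :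
    conv f g x = ((∫ t, ‖f (x - t)‖ * ‖g t‖ : ℝ) : ℂ) := by
  rw [conv_apply_swap]
  refine (integral_congr_ae ?_).trans (integral_ofReal (𝕜 := ℂ))
  filter_upwards [ae_sub_left hf x, hg] with t h1 h2
  rw [h1, h2]
  simp

theorem AeNonneg.conv {f g : V → ℂ} (hf : AeNonneg f) (hg : AeNonneg g) :
    AeNonneg (conv f g) := by
  refine Eventually.of_forall fun x => ?_
  rw [hf.conv_eq hg, norm_real, Real.norm_of_nonneg]
  exact integral_nonneg fun t => by positivity

theorem VanishBelow.ae_mul_eq_zero_of_aeNonneg {ℓ : V →L[ℝ] ℝ} {f g : V → ℂ} {T : ℝ}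
    (hf : Integrable f volume) (hg : Integrable g volume) (hf₀ : AeNonneg f) (hg₀ : AeNonneg g)
    (h : VanishBelow ℓ (conv f g) T) : ∀ᵐ x, ℓ x < T → ∀ᵐ t, f (x - t) * g t = 0 := by
  filter_upwards [h, ae_integrable_conv_integrand hf hg] with x hx hi hxT
  have h1 := hx hxT
  rw [hf₀.conv_eq hg₀, ofReal_eq_zero, integral_eq_zero_iff_of_nonneg] at h1
  · filter_upwards [h1] with t ht
    simpa using ht
  · exact fun t => by positivity
  · simpa using (hi.comp_sub_left x).norm

/-- If `f (x - t) g t` vanishes for almost all `x` in a half-space and almost all `t`, then one of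
the factors vanishes on the corresponding half-space. -/
theorem vanishBelow_or_of_ae_mul_eq_zero {ℓ : V →L[ℝ] ℝ} {f g : V → ℂ} {T a b : ℝ}
    (hf : AEStronglyMeasurable f volume) (hg : AEStronglyMeasurable g volume)
    (h : ∀ᵐ x, ℓ x < T → ∀ᵐ t, f (x - t) * g t = 0) (hab : a + b ≤ T) :
    VanishBelow ℓ f a ∨ VanishBelow ℓ g b := by
  set A : Set V := {t | hf.mk f t ≠ 0 ∧ ℓ t < a} with hA
  set B : Set V := {t | hg.mk g t ≠ 0 ∧ ℓ t < b} with hB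
  have hAm : MeasurableSet A :=
    (hf.stronglyMeasurable_mk.measurable (measurableSet_singleton 0).compl).inter
      (measurableSet_lt ℓ.continuous.measurable measurable_const)
  have hBm : MeasurableSet B :=
    (hg.stronglyMeasurable_mk.measurable (measurableSet_singleton 0).compl).inter
      (measurableSet_lt ℓ.continuous.measurable measurable_const)
  have hAi : Measurable (A.indicator (1 : V → ℝ≥0∞)) := measurable_one.indicator hAm
  have hBi : Measurable (B.indicator (1 : V → ℝ≥0∞)) := measurable_one.indicator hBm
  -- The same double integral is computed twice: it is zero by hypothesis, since `A + B` lies in `{ℓ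
  -- < T}`, and by Tonelli it is the product of the two measures.
  have e₁ : ∫⁻ x, ∫⁻ t, A.indicator 1 (x - t) * B.indicator 1 t = 0 := by
    rw [lintegral_eq_zero_iff']
    · filter_upwards [h] with x hx
      refine (lintegral_congr_ae ?_).trans lintegral_zero
      by_cases hxT : ℓ x < T
      · filter_upwards [hx hxT, ae_sub_left hf.ae_eq_mk x, hg.ae_eq_mk] with t h1 h2 h3
        rw [h2, h3] at h1
        rcases mul_eq_zero.1 h1 with h1 | h1 <;> simp [hA, hB, h1]
      · refine Eventually.of_forall fun t => ?_
        by_cases h1 : x - t ∈ A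
        · by_cases h2 : t ∈ B
          · have h3 := h1.2
            have h4 := h2.2
            rw [map_sub] at h3
            linarith
          · simp [h2]
        · simp [h1]
    · exact (Measurable.lintegral_prod_right' (f := fun z : V × V =>
        A.indicator 1 (z.1 - z.2) * B.indicator 1 z.2)
        ((hAi.comp (measurable_fst.sub measurable_snd)).mul (hBi.comp measurable_snd))).aemeasurable
  have e₂ : ∫⁻ x, ∫⁻ t, A.indicator 1 (x - t) * B.indicator 1 t
      = (volume A : ℝ≥0∞) * volume B := by
    rw [lintegral_lintegral_swap]
    · have : ∀ t, ∫⁻ x, A.indicator (1 : V → ℝ≥0∞) (x - t) * B.indicator 1 t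
          = volume A * B.indicator 1 t := by
        intro t
        have hm : Measurable fun x => A.indicator (1 : V → ℝ≥0∞) (x - t) :=
          hAi.comp (measurable_id.sub_const t)
        rw [lintegral_mul_const _ hm,
          lintegral_sub_right_eq_self (fun x => A.indicator (1 : V → ℝ≥0∞) x) t,
          lintegral_indicator_one hAm]
      simp_rw [this]
      rw [lintegral_const_mul _ hBi, lintegral_indicator_one hBm]
    · exact ((hAi.comp (measurable_fst.sub measurable_snd)).mul
        (hBi.comp measurable_snd)).aemeasurable
  rw [e₁, eq_comm, mul_eq_zero] at e₂
  rcases e₂ with h0 | h0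
  · left
    filter_upwards [hf.ae_eq_mk, measure_eq_zero_iff_ae_notMem.1 h0] with t h1 h2 h3
    by_contra h4
    exact h2 ⟨by rwa [← h1], h3⟩
  · right
    filter_upwards [hg.ae_eq_mk, measure_eq_zero_iff_ae_notMem.1 h0] with t h1 h2 h3
    by_contra h4
    exact h2 ⟨by rwa [← h1], h3⟩

end HalfSpace

/-! ### The Titchmarsh property -/

section Titchmarsh

variable {V : Type*} [NormedAddCommGroup V] [InnerProductSpace ℝ V] [FiniteDimensional ℝ V]
  [MeasurableSpace V] [BorelSpace V]

/-- A class of functions that is closed under convolution and satisfies the Titchmarsh convolution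
property in every half-space. -/
structure TitchmarshClass (K : (V → ℂ) → Prop) : Prop where
  conv : ∀ {f g}, K f → K g → K (conv f g)
  -- Stating this by non-vanishing avoids the endpoint of the support, which may be `-∞` in the
  -- nonnegative case.
  not_vanishBelow_conv : ∀ {ℓ : V →L[ℝ] ℝ} {f g : V → ℂ} {a b : ℝ}, K f → K g →
    ¬VanishBelow ℓ f a → ¬VanishBelow ℓ g b → ¬VanishBelow ℓ (_root_.conv f g) (a + b)

theorem titchmarshClass_integrableBdd : TitchmarshClass (IntegrableBdd (V := V)) where
  conv hf hg := hf.conv hg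
  not_vanishBelow_conv hf hg ha hb h :=
    (vanishBelow_or_of_ae_mul_eq_zero hf.integrable.1 hg.integrable.1
      (h.ae_mul_eq_zero_of_integrableBdd hf hg) le_rfl).elim ha hb

theorem titchmarshClass_aeNonneg :
    TitchmarshClass fun f : V → ℂ => Integrable f volume ∧ AeNonneg f where
  conv hf hg := ⟨integrable_conv hf.1 hg.1, hf.2.conv hg.2⟩
  not_vanishBelow_conv hf hg ha hb h :=
    (vanishBelow_or_of_ae_mul_eq_zero hf.1.1 hg.1.1
      (h.ae_mul_eq_zero_of_aeNonneg hf.1 hg.1 hf.2 hg.2) le_rfl).elim ha hb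

end Titchmarsh

/-! ### Supports, lattices and coordinate widths -/

section Euclidean

variable {d : ℕ}

theorem TitchmarshClass.iterConv {K : (EuclideanSpace ℝ (Fin d) → ℂ) → Prop}
    (hK : TitchmarshClass K) : ∀ (n : ℕ) (f : Fin (n + 1) → EuclideanSpace ℝ (Fin d) → ℂ),
      (∀ i, K (f i)) → K (iterConv (n + 1) f)
  | 0, _, hf => hf 0
  | n + 1, f, hf => hK.conv (hK.iterConv n (Fin.init f) fun i => hf i.castSucc) (hf _)

theorem TitchmarshClass.not_vanishBelow_iterConv {K : (EuclideanSpace ℝ (Fin d) → ℂ) → Prop}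
    (hK : TitchmarshClass K) (ℓ : EuclideanSpace ℝ (Fin d) →L[ℝ] ℝ) :
    ∀ (n : ℕ) (f : Fin (n + 1) → EuclideanSpace ℝ (Fin d) → ℂ) (a : Fin (n + 1) → ℝ),
      (∀ i, K (f i)) → (∀ i, ¬VanishBelow ℓ (f i) (a i)) →
        ¬VanishBelow ℓ (_root_.iterConv (n + 1) f) (∑ i, a i)
  | 0, f, a, _, ha => by simpa [_root_.iterConv] using ha 0
  | n + 1, f, a, hf, ha => by
    rw [Fin.sum_univ_castSucc]
    exact hK.not_vanishBelow_conv (hK.iterConv n (Fin.init f) fun i => hf i.castSucc) (hf _)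
      (hK.not_vanishBelow_iterConv ℓ n (Fin.init f) (fun i => a i.castSucc)
        (fun i => hf i.castSucc) fun i => ha i.castSucc) (ha _)

theorem ae_mem_essSupp (f : EuclideanSpace ℝ (Fin d) → ℂ) : ∀ᵐ x, f x ≠ 0 → x ∈ essSupp f := by
  have : volume ((essSupp f)ᶜ ∩ Function.support f) = 0 := by
    refine measure_null_of_locally_null _ fun x hx => ?_
    obtain ⟨U, hU, h0⟩ : ∃ U ∈ 𝓝 x, volume (U ∩ Function.support f) = 0 := by
      simpa [essSupp] using hx.1
    refine ⟨U ∩ Function.support f, ?_, h0⟩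
    exact inter_mem (mem_nhdsWithin_of_mem_nhds hU)
      (mem_of_superset self_mem_nhdsWithin inter_subset_right)
  filter_upwards [measure_eq_zero_iff_ae_notMem.1 this] with x hx h0
  by_contra h1
  exact hx ⟨h1, h0⟩

theorem exists_mem_essSupp_of_not_vanishBelow {f : EuclideanSpace ℝ (Fin d) → ℂ}
    {ℓ : EuclideanSpace ℝ (Fin d) →L[ℝ] ℝ} {a : ℝ} (h : ¬VanishBelow ℓ f a) :
    ∃ x ∈ essSupp f, ℓ x < a := by
  by_contra! hne
  refine h ?_
  filter_upwards [ae_mem_essSupp f] with x hx hlt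
  by_contra h0
  exact absurd (hne x (hx h0)) (not_le.2 hlt)

theorem not_vanishBelow_of_mem_essSupp {f : EuclideanSpace ℝ (Fin d) → ℂ}
    {ℓ : EuclideanSpace ℝ (Fin d) →L[ℝ] ℝ} {a : ℝ} {x : EuclideanSpace ℝ (Fin d)}
    (hx : x ∈ essSupp f) (hlt : ℓ x < a) : ¬VanishBelow ℓ f a := by
  intro h
  refine hx {y | ℓ y < a} ((isOpen_lt ℓ.continuous continuous_const).mem_nhds hlt) ?_
  refine measure_eq_zero_iff_ae_notMem.2 ?_
  filter_upwards [h] with y hy hm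
  exact hm.2 (hy hm.1)

theorem integrableBdd_of_isBounded_essSupp {f : EuclideanSpace ℝ (Fin d) → ℂ}
    (hf : Integrable f volume) (hb : Bornology.IsBounded (essSupp f)) : IntegrableBdd f := by
  obtain ⟨R, hR⟩ := hb.exists_norm_le
  exact ⟨hf, R, (ae_mem_essSupp f).mono fun x hx h0 => hR x (hx h0)⟩

/-- A function that tiles with a lattice at a nonzero level has support of measure at least the
covolume of the lattice. -/
theorem TilesAtLevel.covolume_le_volume_support {f : EuclideanSpace ℝ (Fin d) → ℂ}
    {Λ : Submodule ℤ (EuclideanSpace ℝ (Fin d))} [DiscreteTopology Λ] [IsZLattice ℝ Λ] {c : ℂ}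
    (h : TilesAtLevel f (Λ : Set (EuclideanSpace ℝ (Fin d))) c) (hc : c ≠ 0) :
    ENNReal.ofReal (ZLattice.covolume Λ) ≤ volume (Function.support f) := by
  have hF := ZLattice.isAddFundamentalDomain (Module.Free.chooseBasis ℤ Λ)
    (volume : Measure (EuclideanSpace ℝ (Fin d)))
  rw [ZLattice.covolume_eq_measure_fundamentalDomain Λ volume hF]
  refine ENNReal.ofReal_toReal_le.trans ?_
  have : VAddInvariantMeasure Λ (EuclideanSpace ℝ (Fin d)) volume :=
    inferInstanceAs (VAddInvariantMeasure Λ.toAddSubgroup (EuclideanSpace ℝ (Fin d)) volume)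
  have : MeasurableConstVAdd Λ (EuclideanSpace ℝ (Fin d)) :=
    inferInstanceAs (MeasurableConstVAdd Λ.toAddSubgroup (EuclideanSpace ℝ (Fin d)))
  rw [hF.measure_eq_tsum (Function.support f)]
  refine le_trans ?_ (measure_iUnion_le _)
  refine measure_mono_ae ?_
  filter_upwards [h] with x hx hxF
  -- A non-zero sum has a non-zero term, so translates of the support cover almost all of the
  -- fundamental domain.
  obtain ⟨l, hl⟩ : ∃ l : Λ, f (x - l) ≠ 0 := by
    by_contra! h0
    have h1 : HasSum (fun l : Λ => f (x - l)) 0 := by simp [h0, hasSum_zero]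
    exact hc (hx.unique h1)
  refine mem_iUnion.2 ⟨l, ?_, hxF⟩
  exact ⟨x - l, hl, by simp [Submodule.vadd_def]⟩

theorem volume_coordinate_box (u v : Fin d → ℝ) :
    volume {x : EuclideanSpace ℝ (Fin d) | ∀ j, x j ∈ Icc (u j) (v j)}
      = ∏ j, ENNReal.ofReal (v j - u j) := by
  rw [← Real.volume_Icc_pi, ← (PiLp.volume_preserving_ofLp (Fin d)).measure_preimage
    measurableSet_Icc.nullMeasurableSet]
  congr 1
  ext x
  simp [Pi.le_def, forall_and]

/-- A function with large support has some coordinate in which its support is wide. -/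
theorem exists_wide_coordinate {f : EuclideanSpace ℝ (Fin d) → ℂ} {L : ℝ} (hL : 0 < L)
    (h : ENNReal.ofReal (2 * L) ^ d < volume (Function.support f)) :
    ∃ (j : Fin d) (a b : ℝ), ¬VanishBelow (EuclideanSpace.proj j) f a ∧
      ¬VanishBelow (-EuclideanSpace.proj j) f (-b) ∧ L < b - a := by
  by_contra! hcon
  refine absurd h (not_lt.2 ?_)
  obtain ⟨x, hx⟩ : (essSupp f).Nonempty := by
    by_contra! hemp
    have h0 : volume (Function.support f) = 0 := by
      refine measure_eq_zero_iff_ae_notMem.2 ?_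
      filter_upwards [ae_mem_essSupp f] with x hx h1
      simpa [hemp] using hx h1
    simp [h0] at h
  have key : ∀ j : Fin d, ∃ u v : ℝ, v - u ≤ 2 * L ∧ VanishBelow (EuclideanSpace.proj j) f u ∧
      VanishBelow (-EuclideanSpace.proj j) f (-v) := by
    intro j
    set A : Set ℝ := {a | ¬VanishBelow (EuclideanSpace.proj j) f a}
    set B : Set ℝ := {b | ¬VanishBelow (-EuclideanSpace.proj j) f (-b)}
    have hA : x j + 1 ∈ A := not_vanishBelow_of_mem_essSupp hx (by simp)
    have hB : x j - 1 ∈ B := not_vanishBelow_of_mem_essSupp hx (by simp)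
    have hAb : BddBelow A := ⟨x j - 1 - L, fun a ha => by linarith [hcon j a _ ha hB]⟩
    have hBb : BddAbove B := ⟨x j + 1 + L, fun b hb => by linarith [hcon j _ b hA hb]⟩
    -- Near-extremal `a` and `b` differ by at most `L`; enlarging by `L / 2` on each side passes
    -- both extremes and gives a box of side at most `2 * L`.
    obtain ⟨a, ha, ha'⟩ := exists_lt_of_csInf_lt ⟨_, hA⟩
      (lt_add_of_pos_right (sInf A) (half_pos hL))
    obtain ⟨b, hb, hb'⟩ := exists_lt_of_lt_csSup ⟨_, hB⟩
      (sub_lt_self (sSup B) (half_pos hL))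
    refine ⟨a - L / 2, b + L / 2, by linarith [hcon j a b ha hb], ?_, ?_⟩
    · by_contra hmem
      linarith [csInf_le hAb (show a - L / 2 ∈ A from hmem)]
    · by_contra hmem
      linarith [le_csSup hBb (show b + L / 2 ∈ B from hmem)]
  choose u v huv hu hv using key
  calc volume (Function.support f)
      ≤ volume {x : EuclideanSpace ℝ (Fin d) | ∀ j, x j ∈ Icc (u j) (v j)} := by
        refine measure_mono_ae ?_
        filter_upwards [ae_all_iff.2 hu, ae_all_iff.2 hv] with y h1 h2 h3 j
        refine ⟨not_lt.1 fun hlt => h3 (h1 j hlt), not_lt.1 fun hlt => h3 (h2 j ?_)⟩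
        simpa using hlt
    _ = ∏ j, ENNReal.ofReal (v j - u j) := volume_coordinate_box u v
    _ ≤ ∏ _j : Fin d, ENNReal.ofReal (2 * L) :=
        Finset.prod_le_prod' fun j _ => ENNReal.ofReal_le_ofReal (huv j)
    _ = ENNReal.ofReal (2 * L) ^ d := by simp

/-- A function with large support has large total coordinate width. -/
theorem exists_total_width {f : EuclideanSpace ℝ (Fin d) → ℂ} {L : ℝ} (hL : 0 < L)
    (h : ENNReal.ofReal (2 * L) ^ d < volume (Function.support f)) :
    ∃ a b : Fin d → ℝ, (∀ j, ¬VanishBelow (EuclideanSpace.proj j) f (a j)) ∧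
      (∀ j, ¬VanishBelow (-EuclideanSpace.proj j) f (-b j)) ∧ L / 2 ≤ ∑ j, (b j - a j) := by
  obtain ⟨j₀, a₀, b₀, ha₀, hb₀, hL₀⟩ := exists_wide_coordinate hL h
  obtain ⟨x, hx, -⟩ := exists_mem_essSupp_of_not_vanishBelow ha₀
  have hd : (0 : ℝ) < d := Nat.cast_pos.2 (Fin.pos j₀)
  -- In the other coordinates a support point gives width `-2η`; this choice makes the total loss at
  -- most `2dη = L / 2`.
  set η : ℝ := L / (4 * d) with hη
  have hη0 : 0 < η := by positivity
  refine ⟨Function.update (fun j => x j + η) j₀ a₀, Function.update (fun j => x j - η) j₀ b₀,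
    fun j => ?_, fun j => ?_, ?_⟩
  · rcases eq_or_ne j j₀ with rfl | hj
    · simpa using ha₀
    · rw [Function.update_of_ne hj]
      exact not_vanishBelow_of_mem_essSupp hx (by simpa using hη0)
  · rcases eq_or_ne j j₀ with rfl | hj
    · simpa using hb₀
    · rw [Function.update_of_ne hj]
      exact not_vanishBelow_of_mem_essSupp hx (by simpa using hη0)
  · calc L / 2 = ∑ j : Fin d, ((if j = j₀ then L else 0) - 2 * η) := by
          rw [Finset.sum_sub_distrib, Finset.sum_ite_eq' Finset.univ j₀]
          simp [hη]
          field_simp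
          ring
      _ ≤ _ := by
          refine Finset.sum_le_sum fun j _ => ?_
          rcases eq_or_ne j j₀ with rfl | hj
          · simp only [Function.update_self, if_true]
            linarith
          · simp only [Function.update_of_ne hj, if_neg hj]
            linarith

/-- The diameter of the support of a convolution is at least the sum of the coordinate widths of
the factors, up to the dimension. -/
theorem TitchmarshClass.le_ediam_essSupp_iterConv {K : (EuclideanSpace ℝ (Fin d) → ℂ) → Prop}
    (hK : TitchmarshClass K) (hd : 1 ≤ d) {N : ℕ} (hN : 1 ≤ N)
    {f : Fin N → EuclideanSpace ℝ (Fin d) → ℂ} (hf : ∀ i, K (f i)) {L : ℝ} (hL : 0 < L)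
    (h : ∀ i, ENNReal.ofReal (2 * L) ^ d < volume (Function.support (f i))) :
    ENNReal.ofReal (L / (2 * d) * N) ≤ Metric.ediam (essSupp (_root_.iterConv N f)) := by
  obtain ⟨n, rfl⟩ := Nat.exists_eq_add_of_le' hN
  choose a b ha hb hab using fun i => exists_total_width hL (h i)
  have hd0 : (0 : ℝ) < d := by exact_mod_cast hd
  -- The wide coordinate varies with the factor, so the pigeonhole is applied to total widths:
  -- together at least `N * L / 2`, shared among `d` coordinates.
  obtain ⟨j, hj⟩ : ∃ j, L / (2 * d) * (n + 1 : ℕ) ≤ ∑ i, (b i j - a i j) := by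
    by_contra! hlt
    have : Nonempty (Fin d) := ⟨⟨0, hd⟩⟩
    have h1 : ∑ j, ∑ i, (b i j - a i j) < ∑ _j : Fin d, L / (2 * d) * (n + 1 : ℕ) :=
      Finset.sum_lt_sum_of_nonempty Finset.univ_nonempty fun j _ => hlt j
    have h2 : ∑ _i : Fin (n + 1), L / 2 ≤ ∑ i, ∑ j, (b i j - a i j) :=
      Finset.sum_le_sum fun i _ => hab i
    rw [Finset.sum_comm] at h1
    have h3 : ∑ _j : Fin d, L / (2 * d) * (n + 1 : ℕ) = ∑ _i : Fin (n + 1), L / 2 := by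
      simp
      field_simp
    linarith
  obtain ⟨p, hp, hpa⟩ := exists_mem_essSupp_of_not_vanishBelow
    (hK.not_vanishBelow_iterConv (EuclideanSpace.proj j) n f _ hf fun i => ha i j)
  obtain ⟨q, hq, hqb⟩ := exists_mem_essSupp_of_not_vanishBelow
    (hK.not_vanishBelow_iterConv (-EuclideanSpace.proj j) n f _ hf fun i => hb i j)
  refine le_trans ?_ (Metric.edist_le_ediam_of_mem hp hq)
  rw [edist_dist]
  refine ENNReal.ofReal_le_ofReal (hj.trans ?_)
  rw [Finset.sum_sub_distrib]
  have h1 : ‖(p - q) j‖ ≤ ‖p - q‖ := PiLp.norm_apply_le (p - q) j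
  rw [PiLp.sub_apply, Real.norm_eq_abs] at h1
  rw [dist_eq_norm]
  have hpa' : p j < ∑ i, a i j := hpa
  have hqb' : -q j < ∑ i, -b i j := hqb
  rw [Finset.sum_neg_distrib] at hqb'
  linarith [neg_abs_le (p j - q j)]

end Euclidean

theorem mainTheorem6 (d : ℕ) (hd : 1 ≤ d) :
    ∃ C : ℝ, 0 < C ∧
      ∀ (c₁ : ℝ), 0 < c₁ →
      ∀ (N : ℕ), 1 ≤ N →
      ∀ (Λ : Fin N → Submodule ℤ (EuclideanSpace ℝ (Fin d)))
        [∀ i, DiscreteTopology (Λ i)] [∀ i, IsZLattice ℝ (Λ i)],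
        (∀ i, c₁ ≤ ZLattice.covolume (Λ i)) →
      ∀ (f : Fin N → EuclideanSpace ℝ (Fin d) → ℂ),
        (∀ i, Integrable (f i) volume) →
        (∀ i, ∃ c : ℂ, c ≠ 0 ∧ TilesAtLevel (f i) (Λ i : Set (EuclideanSpace ℝ (Fin d))) c) →
        ((∀ i, Bornology.IsBounded (essSupp (f i))) ∨
          (∀ i, ∀ᵐ x ∂volume, 0 ≤ (f i x).re ∧ (f i x).im = 0)) →
        ENNReal.ofReal (C * c₁ ^ ((1 : ℝ) / d) * N) ≤ Metric.ediam (essSupp (iterConv N f)) := by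
  have hd0 : (0 : ℝ) < d := by exact_mod_cast hd
  -- With `L = r / 4` and `r = c₁ ^ (1 / d)`, the bound `L / (2 * d)` per factor is `r / (8 * d)`.
  -- Then `2 * L = r / 2`, whose `d`-th power is strictly below `c₁`.
  refine ⟨1 / (8 * d), by positivity, ?_⟩
  intro c₁ hc₁ N hN Λ _ _ hcov f hf htile hcase
  set r : ℝ := c₁ ^ ((1 : ℝ) / d) with hr
  have hr0 : 0 < r := Real.rpow_pos_of_pos hc₁ _
  have hrd : r ^ d = c₁ := by
    rw [hr, one_div]
    exact Real.rpow_inv_natCast_pow hc₁.le (by omega)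
  have hvol : ∀ i, ENNReal.ofReal (2 * (r / 4)) ^ d < volume (Function.support (f i)) := by
    intro i
    obtain ⟨c, hc, ht⟩ := htile i
    refine lt_of_lt_of_le ?_
      ((ENNReal.ofReal_le_ofReal (hcov i)).trans (ht.covolume_le_volume_support hc))
    rw [← ENNReal.ofReal_pow (by positivity), ENNReal.ofReal_lt_ofReal_iff hc₁, ← hrd]
    exact pow_lt_pow_left₀ (by linarith) (by positivity) (by omega)
  have e : 1 / (8 * d) * r * N = r / 4 / (2 * d) * N := by
    field_simp
    norm_num
  rw [e]
  rcases hcase with hb | hnn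
  · exact titchmarshClass_integrableBdd.le_ediam_essSupp_iterConv hd hN
      (fun i => integrableBdd_of_isBounded_essSupp (hf i) (hb i)) (by positivity) hvol
  · refine titchmarshClass_aeNonneg.le_ediam_essSupp_iterConv hd hN
      (fun i => ⟨hf i, ?_⟩) (by positivity) hvol
    filter_upwards [hnn i] with x hx
    have h1 : f i x = ((f i x).re : ℂ) := Complex.ext rfl (by simp [hx.2])
    rw [h1, norm_real, Real.norm_of_nonneg hx.1]
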